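/- \textbf{Definitions.} A \emph{linear compartmental model} $\mathcal M=(G,\mathit{In},\mathit{Out},\mathit{Leak})$ consists of a finite directed graph $G=(V,E)$ and sets $\mathit{In},\mathit{Out},\mathit{Leak}\subseteq V$ with $\mathit{In}\neq\varnothing$ and $\mathit{Out}\neq\varnothing$. It has a real parameter $k_{ij}$ for each edge $j\to i$ of $G$ and a real parameter $k_{0\ell}$ for each $\ell\in\mathit{Leak}$. Its compartmental matrix $A$ has off-diagonal entries $a_{ij}=k_{ij}$ if $j\to i$ is an edge and $a_{ij}=0$ otherwise, and diagonal entries $a_{ii}=-k_{0i}-\sum_{p:\,i\to p\in E}k_{pi}$, where the term $k_{0i}$ is omitted if $i\notin\mathit{Leak}$. For each $i\in\mathit{Out}$ the input-output equation is $$\det(\partial I-A)\,y_i=\sum_{j\in\mathit{In}}(-1)^{i+j}\det\big[(\partial I-A)^{j,i}\big]\,u_j ,$$ where $\partial=d/dt$ and $(B)^{j,i}$ denotes $B$ with row $j$ and column $i$ removed. The \emph{coefficient map} $\mathsf c:\mathbb R^{|E|+|\mathit{Leak}|}\to\mathbb R^m$ sends the vector of parameters to the vector of all coefficients (of the derivatives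 $y_i^{(d)}$ and $u_j^{(d)}$) of these equations for $i\in\mathit{Out}$. The model is \emph{generically locally identifiable} if every point of $\mathbb R^{|E|+|\mathit{Leak}|}$ outside a set of Lebesgue measure zero has a neighbourhood on which $\mathsf c$ is injective. A \emph{directed-cycle model} is a linear compartmental model with $V=\{1,\dots,n\}$, $n\ge 3$, and $E=\{1\to2,\ 2\to3,\ \dots,\ (n-1)\to n,\ n\to1\}$. It is \emph{exceptional} if, for some $i$, $\mathit{In}=\{i\}$, $\mathit{Out}=\{i-1\}$, $|\mathit{Leak}|=2$ and $i-1\in\mathit{Leak}$ ($i-1$ taken mod $n$). It is \emph{leak-interlacing} if it is not exceptional and, in addition, either $|\mathit{Leak}|\le1$, or $\mathit{Leak}=\{\ell_1<\ell_2<\dots<\ell_z\}$ with $z\ge2$ and, for every $\alpha\in\{1,\dots,z\}$, $$\{\ell_\alpha+1,\ \ell_\alpha+2,\ \dots,\ \ell_{\alpha+1}\}\cap(\mathit{In}\cup\mathit{Out})\neq\varnothing ,$$ where $\ell_{z+1}:=\ell_1$ and the compartments $\ell_z+1,\dots,\ell_1$ are taken mod $n$. \textbf{Theorem.} A directed-cycle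 model (with any numbers of inputs, outputs and leaks, but at least one input and at least one output) is generically locally identifiable if and only if it is leak-interlacing. -/

import Mathlib

open scoped Topology Polynomial

noncomputable section

/-- A linear compartmental model `(G, In, Out, Leak)` with `G = (V, E)` a finite directed graph.
A pair `(j, i)` in `edges` is the edge `j → i`.  There is at least one input and at least
one output. -/
structure LinearCompartmentalModel (V : Type*) [Fintype V] [DecidableEq V] where
  edges : Finset (V × V)
  In : Finset V
  Out : Finset V
  Leak : Finset V
  in_nonempty : In.Nonempty
  out_nonempty : Out.Nonempty

namespace LinearCompartmentalModel

section General

variable {V : Type*} [Fintype V] [DecidableEq V] (M : LinearCompartmentalModel V)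

/-- The index set of the parameters: one for each edge and one for each leak. -/
abbrev ParamIndex : Type _ := M.edges ⊕ M.Leak

/-- The parameter space `ℝ^(|E| + |Leak|)`. -/
abbrev Params : Type _ := M.ParamIndex → ℝ

/-- The parameter `k_{ij}` of the edge `j → i` (and `0` if there is no such edge). -/
def edgeParam (k : M.Params) (i j : V) : ℝ :=
  if h : (j, i) ∈ M.edges then k (Sum.inl ⟨(j, i), h⟩) else 0

/-- The parameter `k_{0i}` of the leak at `i` (and `0` if `i` is not a leak compartment). -/
def leakParam (k : M.Params) (i : V) : ℝ :=
  if h : i ∈ M.Leak then k (Sum.inr ⟨i, h⟩) else 0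

/-- The compartmental matrix `A`. -/
def compartmentalMatrix (k : M.Params) : Matrix V V ℝ :=
  Matrix.of fun i j =>
    if i = j then -M.leakParam k i - ∑ p, M.edgeParam k p i else M.edgeParam k i j

/-- The polynomial in `∂ = d/dt` that acts on `y_i`, for every output `i`, in the input-output
equation `det (∂ I - A) y_i = ∑_{j ∈ In} (-1)^(i+j) det ((∂ I - A)^{j,i}) u_j`. -/
def outputPoly (k : M.Params) : ℝ[X] :=
  (M.compartmentalMatrix k).charmatrix.det

/-- The polynomial in `∂` that acts on `u_j` in the input-output equation of the output `i`,
namely `(-1)^(i+j) det ((∂ I - A)^{j,i})`, the determinant without row `j` and column `i`.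
This is the `(i, j)` entry of the adjugate of `∂ I - A` (see `inputPoly_eq`). -/
def inputPoly (k : M.Params) (i j : V) : ℝ[X] :=
  (M.compartmentalMatrix k).charmatrix.adjugate i j

/-- The coefficients of the input-output equations: those of `y_i^(d)` for `i ∈ Out`,
and those of `u_j^(d)` for `i ∈ Out` and `j ∈ In`. -/
abbrev CoeffIndex : Type _ :=
  (M.Out × Fin (Fintype.card V + 1)) ⊕ (M.Out × M.In × Fin (Fintype.card V))

/-- The coefficient map.  All coefficients are listed; those that do not depend on the
parameters have no effect on injectivity. -/
def coeffMap (k : M.Params) : M.CoeffIndex → ℝ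
  | Sum.inl (_, d) => (M.outputPoly k).coeff d
  | Sum.inr (i, j, d) => (M.inputPoly k i j).coeff d

/-- Generic local identifiability: outside a set of Lebesgue measure zero, every point of the
parameter space has a neighbourhood on which the coefficient map is injective. -/
def GenericallyLocallyIdentifiable : Prop :=
  ∀ᵐ k : M.Params, ∃ U ∈ 𝓝 k, Set.InjOn M.coeffMap U

end General

theorem inputPoly_eq {m : ℕ} (M : LinearCompartmentalModel (Fin (m + 1))) (k : M.Params)
    (i j : Fin (m + 1)) :
    M.inputPoly k i j = (-1) ^ ((i : ℕ) + (j : ℕ)) *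
      ((M.compartmentalMatrix k).charmatrix.submatrix j.succAbove i.succAbove).det := by
  rw [inputPoly, Matrix.adjugate_fin_succ_eq_det_submatrix, add_comm (i : ℕ)]

section Cycle

variable {n : ℕ} [NeZero n] (M : LinearCompartmentalModel (Fin n))

/-- A directed-cycle model: `n ≥ 3` compartments and the edges `1 → 2 → ⋯ → n → 1`.
The element `i : Fin n` stands for the compartment `i + 1`; the addition of `Fin n` is modulo
`n`. -/
def IsDirectedCycle : Prop :=
  3 ≤ n ∧ M.edges = Finset.univ.image fun i : Fin n => (i, i + 1)

/-- `In = {i}`, `Out = {i - 1}`, `|Leak| = 2` and `i - 1 ∈ Leak`, for some `i`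
(with `i - 1` modulo `n`). -/
def IsExceptional : Prop :=
  ∃ i : Fin n, M.In = {i} ∧ M.Out = {i - 1} ∧ M.Leak.card = 2 ∧ i - 1 ∈ M.Leak

/-- The compartments `a + 1, a + 2, …, b`, modulo `n` (all of them if `a = b`). -/
def stretch (a b : Fin n) : Finset (Fin n) :=
  if a < b then Finset.Ioc a b else Finset.Ioi a ∪ Finset.Iic b

/-- The leaks in increasing order, `ℓ_1 < ℓ_2 < ⋯ < ℓ_z`. -/
def leakAt : Fin M.Leak.card ↪o Fin n := M.Leak.orderEmbOfFin rfl

/-- Leak-interlacing.  The permutation `finRotate z` sends `α` to `α + 1`, and the last index to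
the first. -/
def IsLeakInterlacing : Prop :=
  ¬ M.IsExceptional ∧
    (M.Leak.card ≤ 1 ∨
      (2 ≤ M.Leak.card ∧ ∀ α : Fin M.Leak.card,
        (stretch (M.leakAt α) (M.leakAt (finRotate M.Leak.card α)) ∩ (M.In ∪ M.Out)).Nonempty))

end Cycle

end LinearCompartmentalModel

end

/-!
Write `a v` for the parameter of the edge `v → v + 1` and `d v` for the sum of `a v` and the leak
parameter of `v`, so that `d v = a v` off the leaks. Computing the determinant and the adjugate of
`∂ I - A` for a cycle shows that the coefficients amount to the output polynomial
`Q = ∏ (X + d v) - ∏ a v` and, for each input `j` and output `i`, to the product of the `a v` with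
`v` on the path from `j` to `i` (`passed j i`) times `∏ (X + d v)` over the compartments `v` off
that path (`avoided j i`).

Identifiability. For two nearby generic parameter vectors (`Separated`) with equal coefficients, it
suffices to find one compartment `v` at which the values `d v` agree: then `∏ a = -Q (-d v)` agrees,
hence so do all roots of `Q + ∏ a`, that is, all `d v` (`rates_eq_of_outRate_eq`). If `avoided j i`
is nonempty for some input and output, such a `v` is read off from the roots of the input
polynomial. Otherwise `In = {m + 1}` and `Out = {m}`, there is at most one leak
(`leak_card_le_one_of_adjacent`), and `d m` is a simple root of a polynomial built from the
coefficients (`outRate_eq_of_prod_erase_eq`). Once the `d v` and `∏ a` are known, so are the `a v`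
off the leaks and the product of the `a v` over each path from an input to an output. The ratios of
the two edge rates then have product `1` over the cycle and over all these paths, so their partial
products take a single value on `In ∪ Out` and are constant between consecutive leaks; interlacing
forces all ratios to be `1` (`eq_one_of_interlacing`).

Non-identifiability. If no input or output separates two consecutive leaks, the edge rates at these
leaks can be scaled by `t` and `1 / t` with all `d v` fixed (`not_injOn_of_mem_passed_iff`). In an
exceptional model there is one coefficient less than there are parameters, and an explicit curve in
the fibre is obtained by moving `∏ a` and following the roots of `Q + ∏ a`
(`not_injOn_of_isExceptional`, `eventually_exists_prod_X_add_C_eq`). Both constructions apply at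
every generic point, and almost every point is generic (`ae_separated`).
-/

namespace LinearCompartmentalModel

/-! ### Cyclic intervals -/

section CyclicIntervals

variable {n : ℕ}

theorem val_sub_eq_ite (a b : Fin n) :
    (a - b).val = if b ≤ a then a.val - b.val else n + a.val - b.val := by
  split_ifs with h
  · exact Fin.coe_sub_iff_le.2 h
  · exact Fin.coe_sub_iff_lt.2 (not_le.1 h)

theorem val_add_one_eq_ite [NeZero n] (a : Fin n) :
    (a + 1).val = if a.val + 1 = n then 0 else a.val + 1 := by
  have ha := a.isLt
  rw [Fin.val_add, Fin.val_one']
  split_ifs with h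
  · rw [Nat.add_mod_mod, h, Nat.mod_self]
  · rw [Nat.add_mod_mod, Nat.mod_eq_of_lt (by omega)]

/-- The compartments `j, j + 1, …, i - 1`, modulo `n`: those whose outgoing edge lies on the
path from `j` to `i`. The set is empty if `i = j`. -/
def passed (j i : Fin n) : Finset (Fin n) :=
  Finset.univ.filter fun v => v - j < i - j

/-- The compartments `i + 1, i + 2, …, j - 1`, modulo `n`: those off the path from `j` to `i`.
These are all compartments but `j` if `i = j`. -/
def avoided (j i : Fin n) : Finset (Fin n) :=
  Finset.univ.filter fun v => i - j < v - j

theorem mem_passed {j i v : Fin n} :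
    v ∈ passed j i ↔ (j ≤ v ∧ v < i) ∨ (i < j ∧ (j ≤ v ∨ v < i)) := by
  have := v.isLt
  have := i.isLt
  simp only [passed, Finset.mem_filter_univ, Fin.lt_def, Fin.le_def, val_sub_eq_ite]
  split_ifs <;> omega

theorem mem_avoided {j i v : Fin n} :
    v ∈ avoided j i ↔ (j ≤ i ∧ (i < v ∨ v < j)) ∨ (i < v ∧ v < j) := by
  have := v.isLt
  have := i.isLt
  simp only [avoided, Finset.mem_filter_univ, Fin.lt_def, Fin.le_def, val_sub_eq_ite]
  split_ifs <;> omega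

theorem self_notMem_passed (j p : Fin n) : p ∉ passed j p := by
  simp [passed]

theorem self_notMem_avoided (j p : Fin n) : p ∉ avoided j p := by
  simp [avoided]

theorem passed_self (j : Fin n) : passed j j = ∅ := by
  ext v
  simp only [mem_passed, Fin.lt_def, Fin.le_def, Finset.notMem_empty, iff_false]
  omega

theorem insert_avoided_self (j : Fin n) : insert j (avoided j j) = Finset.univ := by
  ext v
  simp only [Finset.mem_insert, mem_avoided, Fin.lt_def, Fin.le_def, Fin.ext_iff, Finset.mem_univ,
    iff_true]
  omega

variable [NeZero n]

theorem add_one_ne_self (hn : 2 ≤ n) (i : Fin n) : i + 1 ≠ i := by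
  rw [Ne, Fin.ext_iff, val_add_one_eq_ite]
  split_ifs <;> omega

theorem passed_add_one {j p : Fin n} (h : p + 1 ≠ j) :
    passed j (p + 1) = insert p (passed j p) := by
  ext v
  have := v.isLt
  have := p.isLt
  have := j.isLt
  rw [Ne, Fin.ext_iff, val_add_one_eq_ite] at h
  simp only [Finset.mem_insert, mem_passed, Fin.lt_def, Fin.le_def, Fin.ext_iff,
    val_add_one_eq_ite]
  split_ifs at h ⊢ <;> omega

theorem avoided_eq_insert {j p : Fin n} (h : p + 1 ≠ j) :
    avoided j p = insert (p + 1) (avoided j (p + 1)) := by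
  ext v
  have := v.isLt
  have := p.isLt
  have := j.isLt
  rw [Ne, Fin.ext_iff, val_add_one_eq_ite] at h
  simp only [Finset.mem_insert, mem_avoided, Fin.lt_def, Fin.le_def, Fin.ext_iff,
    val_add_one_eq_ite]
  split_ifs at h ⊢ <;> omega

theorem insert_passed_of_add_one_eq {j p : Fin n} (h : p + 1 = j) :
    insert p (passed j p) = Finset.univ := by
  ext v
  have := v.isLt
  have := p.isLt
  rw [Fin.ext_iff, val_add_one_eq_ite] at h
  simp only [Finset.mem_insert, mem_passed, Fin.lt_def, Fin.le_def, Fin.ext_iff, Finset.mem_univ,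
    iff_true]
  split_ifs at h <;> omega

theorem avoided_of_add_one_eq {j p : Fin n} (h : p + 1 = j) : avoided j p = ∅ := by
  ext v
  have := v.isLt
  have := p.isLt
  rw [Fin.ext_iff, val_add_one_eq_ite] at h
  simp only [mem_avoided, Fin.lt_def, Fin.le_def, Finset.notMem_empty, iff_false]
  split_ifs at h <;> omega

theorem passed_of_add_one_eq {j p : Fin n} (h : p + 1 = j) :
    passed j p = Finset.univ.erase p := by
  rw [← insert_passed_of_add_one_eq h, Finset.erase_insert (self_notMem_passed j p)]

theorem add_one_mem_avoided {j p : Fin n} (h : p + 1 ≠ j) : p + 1 ∈ avoided j p := by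
  rw [avoided_eq_insert h]
  exact Finset.mem_insert_self _ _

end CyclicIntervals

/-! ### The determinant and the adjugate of a cycle matrix -/

section CycleMatrix

variable {n : ℕ} [NeZero n] {R : Type*} [CommRing R]

/-- The matrix with diagonal entries `d i`, with entries `-a i` at the places `(i + 1, i)`,
and with zeros elsewhere. -/
def cycleMatrix (a d : Fin n → R) : Matrix (Fin n) (Fin n) R :=
  Matrix.of fun i j => if i = j then d i else if i = j + 1 then -a j else 0

/-- A permutation that moves each point by `0` or `1` is the identity or the rotation. -/
theorem perm_eq_one_or_finRotate (hn : 2 ≤ n) (σ : Equiv.Perm (Fin n))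
    (h : ∀ i, σ i = i ∨ σ i = i + 1) : σ = 1 ∨ σ = finRotate n := by
  by_cases h1 : ∀ i, σ i = i
  · exact Or.inl (Equiv.ext h1)
  right
  push Not at h1
  obtain ⟨i₀, hi₀⟩ := h1
  have key : ∀ t : ℕ, σ (i₀ + t • 1) = i₀ + t • 1 + 1 := by
    intro t
    induction t with
    | zero => simpa using (h i₀).resolve_left hi₀
    | succ t ih =>
      have hs : i₀ + (t + 1) • (1 : Fin n) = i₀ + t • 1 + 1 := by rw [succ_nsmul, add_assoc]
      refine (h _).resolve_left fun h' => ?_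
      rw [hs, ← ih] at h'
      have := σ.injective h'
      rw [ih] at this
      exact add_one_ne_self hn _ this
  ext1 j
  have hval : ∀ t < n, (t • (1 : Fin n)).val = t := by
    intro t ht
    induction t with
    | zero => simp
    | succ t ih => rw [succ_nsmul, val_add_one_eq_ite, ih (by omega), if_neg ht.ne]
  have := key (j - i₀).val
  rwa [Fin.ext (hval _ (j - i₀).isLt), add_sub_cancel, ← finRotate_apply] at this

theorem det_cycleMatrix (hn : 2 ≤ n) (a d : Fin n → R) :
    (cycleMatrix a d).det = ∏ i, d i - ∏ i, a i := by
  have hne : (1 : Equiv.Perm (Fin n)) ≠ finRotate n := by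
    intro h
    have := congrArg (fun σ : Equiv.Perm (Fin n) => σ 0) h
    simp only [Equiv.Perm.one_apply, finRotate_apply] at this
    exact add_one_ne_self hn _ this.symm
  rw [Matrix.det_apply', Fintype.sum_eq_add 1 (finRotate n) hne]
  · have h1 : ∀ i : Fin n, cycleMatrix a d (i + 1) i = -a i := fun i => by
      simp [cycleMatrix, add_one_ne_self hn i]
    have h2 : ∀ i : Fin n, cycleMatrix a d i i = d i := fun i => by
      simp [cycleMatrix]
    simp only [Equiv.Perm.sign_one, Equiv.Perm.one_apply, h2, finRotate_apply, h1, sign_finRotate,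
      Finset.prod_neg, Finset.card_univ, Fintype.card_fin]
    obtain ⟨k, rfl⟩ : ∃ k, n = k + 1 := ⟨n - 1, by omega⟩
    have hs : ((-1 : R) ^ k) * (-1) ^ (k + 1) = -1 := by
      rw [pow_succ, ← mul_assoc, ← mul_pow]
      simp
    push_cast
    rw [← mul_assoc, hs]
    ring
  · rintro σ ⟨hσ1, hσ2⟩
    have : ∃ i, σ i ≠ i ∧ σ i ≠ i + 1 := by
      by_contra! hcon
      exact (perm_eq_one_or_finRotate hn σ fun i => or_iff_not_imp_left.2 (hcon i)).elim hσ1 hσ2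
    obtain ⟨i, hi1, hi2⟩ := this
    rw [Finset.prod_eq_zero (Finset.mem_univ i), mul_zero]
    simp [cycleMatrix, hi1, hi2]

theorem cycleMatrix_mul (hn : 2 ≤ n) (a d : Fin n → R) :
    cycleMatrix a d * Matrix.of (fun i j => (∏ v ∈ passed j i, a v) * ∏ v ∈ avoided j i, d v) =
      (∏ i, d i - ∏ i, a i) • (1 : Matrix (Fin n) (Fin n) R) := by
  ext i j
  obtain ⟨p, rfl⟩ : ∃ p : Fin n, i = p + 1 := ⟨i - 1, by simp⟩
  have hp := add_one_ne_self hn p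
  rw [Matrix.mul_apply, Fintype.sum_eq_add (p + 1) p hp]
  · simp only [cycleMatrix, Matrix.of_apply, if_true, if_neg hp, Matrix.smul_apply,
      Matrix.one_apply, smul_eq_mul]
    by_cases h : p + 1 = j
    · subst h
      have e1 : ∏ i, d i = d (p + 1) * ∏ v ∈ avoided (p + 1) (p + 1), d v := by
        rw [← insert_avoided_self (p + 1), Finset.prod_insert (self_notMem_avoided _ _)]
      have e2 : ∏ i, a i = a p * ∏ v ∈ passed (p + 1) p, a v := by
        rw [← insert_passed_of_add_one_eq rfl, Finset.prod_insert (self_notMem_passed _ _)]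
      rw [e1, e2, passed_self, avoided_of_add_one_eq rfl]
      simp
      ring
    · rw [avoided_eq_insert h, passed_add_one h, Finset.prod_insert (self_notMem_passed _ _),
        Finset.prod_insert (self_notMem_avoided _ _), if_neg h]
      ring
  · rintro q ⟨h1, h2⟩
    have h2' : ¬ p + 1 = q + 1 := fun h => h2 (add_right_cancel h).symm
    simp [cycleMatrix, h1.symm, h2']

/-- The determinant is assumed to be nonzero, so that the right-hand factor in
`cycleMatrix_mul` is the adjugate by cancellation. -/
theorem adjugate_cycleMatrix [IsDomain R] (hn : 2 ≤ n) (a d : Fin n → R)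
    (h0 : ∏ i, d i - ∏ i, a i ≠ 0) (i j : Fin n) :
    (cycleMatrix a d).adjugate i j = (∏ v ∈ passed j i, a v) * ∏ v ∈ avoided j i, d v := by
  have h1 := congrArg (fun N => (cycleMatrix a d).adjugate * N) (cycleMatrix_mul hn a d)
  simp only [← Matrix.mul_assoc, Matrix.adjugate_mul, det_cycleMatrix hn, Matrix.smul_mul,
    Matrix.one_mul, Matrix.mul_smul, Matrix.mul_one] at h1
  exact (congrFun (congrFun (smul_right_injective _ h0 h1) i) j).symm

end CycleMatrix

/-! ### The coefficient map of a directed-cycle model -/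

section Model

variable {n : ℕ} (M : LinearCompartmentalModel (Fin n))

/-- The parameters with edge rates `a` and, in the leak compartments, outgoing rates `d`. -/
def ofRates (a d : Fin n → ℝ) : M.Params :=
  Sum.elim (fun e => a e.1.1) fun l => d l.1 - a l.1

theorem continuous_ofRates :
    Continuous fun p : (Fin n → ℝ) × (Fin n → ℝ) => M.ofRates p.1 p.2 := by
  refine continuous_pi ?_
  rintro (e | l) <;> simp only [ofRates, Sum.elim_inl, Sum.elim_inr] <;> fun_prop

variable [NeZero n]

/-- The parameter of the edge `i → i + 1`. -/
def edgeRate (k : M.Params) (i : Fin n) : ℝ := M.edgeParam k (i + 1) i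

/-- The total rate at which a directed-cycle model empties the compartment `i`. It equals
`M.edgeRate k i` if `i` has no leak. -/
def outRate (k : M.Params) (i : Fin n) : ℝ := M.leakParam k i + M.edgeRate k i

variable {M}

theorem outRate_eq_edgeRate (k : M.Params) {i : Fin n} (hi : i ∉ M.Leak) :
    M.outRate k i = M.edgeRate k i := by
  simp [outRate, leakParam, hi]

theorem IsDirectedCycle.mem_edges (hM : M.IsDirectedCycle) {i j : Fin n} :
    (j, i) ∈ M.edges ↔ i = j + 1 := by
  rw [hM.2]
  simp [eq_comm]

theorem IsDirectedCycle.two_le (hM : M.IsDirectedCycle) : 2 ≤ n :=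
  le_trans (by norm_num) hM.1

theorem edgeRate_ofRates (hM : M.IsDirectedCycle) (a d : Fin n → ℝ) :
    M.edgeRate (M.ofRates a d) = a := by
  ext i
  rw [edgeRate, edgeParam, dif_pos (hM.mem_edges.2 rfl)]
  rfl

theorem outRate_ofRates (hM : M.IsDirectedCycle) {a d : Fin n → ℝ}
    (h : ∀ i ∉ M.Leak, d i = a i) : M.outRate (M.ofRates a d) = d := by
  ext i
  rw [outRate, edgeRate_ofRates hM, leakParam]
  split_ifs with hi
  · simp [ofRates]
  · rw [h i hi, zero_add]

theorem ofRates_edgeRate_outRate (hM : M.IsDirectedCycle) (k : M.Params) :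
    M.ofRates (M.edgeRate k) (M.outRate k) = k := by
  ext (⟨⟨j, i⟩, h⟩ | ⟨l, hl⟩)
  · obtain rfl := hM.mem_edges.1 h
    simp [ofRates, edgeRate, edgeParam, h]
  · simp [ofRates, outRate, leakParam]

theorem params_ext (hM : M.IsDirectedCycle) {k k' : M.Params}
    (ha : M.edgeRate k = M.edgeRate k') (hd : M.outRate k = M.outRate k') : k = k' := by
  rw [← ofRates_edgeRate_outRate hM k, ha, hd, ofRates_edgeRate_outRate hM k']

theorem continuous_edgeRate (i : Fin n) : Continuous fun k => M.edgeRate k i := by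
  unfold edgeRate edgeParam
  split_ifs <;> fun_prop

theorem continuous_outRate (i : Fin n) : Continuous fun k => M.outRate k i := by
  refine Continuous.add ?_ (continuous_edgeRate i)
  unfold leakParam
  split_ifs <;> fun_prop

theorem charmatrix_compartmentalMatrix (hM : M.IsDirectedCycle) (k : M.Params) :
    (M.compartmentalMatrix k).charmatrix =
      cycleMatrix (fun i => Polynomial.C (M.edgeRate k i))
        fun i => Polynomial.X + Polynomial.C (M.outRate k i) := by
  ext1 i j
  by_cases hij : i = j
  · subst hij
    have hsum : ∑ p, M.edgeParam k p i = M.edgeRate k i := by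
      refine Fintype.sum_eq_single _ fun p hp => ?_
      rw [edgeParam, dif_neg (hM.mem_edges.not.2 hp)]
    rw [Matrix.charmatrix_apply_eq, compartmentalMatrix, Matrix.of_apply, if_pos rfl, hsum,
      cycleMatrix, Matrix.of_apply, if_pos rfl, outRate, ← neg_add', Polynomial.C_neg,
      sub_neg_eq_add]
  · rw [Matrix.charmatrix_apply_ne _ _ _ hij, compartmentalMatrix, Matrix.of_apply, if_neg hij,
      cycleMatrix, Matrix.of_apply, if_neg hij]
    split_ifs with h
    · rw [h, edgeRate]
    · rw [edgeParam, dif_neg (hM.mem_edges.not.2 h), Polynomial.C_0, neg_zero]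

theorem outputPoly_eq_prod (hM : M.IsDirectedCycle) (k : M.Params) :
    M.outputPoly k = ∏ i, (Polynomial.X + Polynomial.C (M.outRate k i)) -
      Polynomial.C (∏ i, M.edgeRate k i) := by
  rw [outputPoly, charmatrix_compartmentalMatrix hM, det_cycleMatrix hM.two_le, map_prod]

theorem inputPoly_eq_prod (hM : M.IsDirectedCycle) (k : M.Params) (i j : Fin n) :
    M.inputPoly k i j = Polynomial.C (∏ v ∈ passed j i, M.edgeRate k v) *
      ∏ v ∈ avoided j i, (Polynomial.X + Polynomial.C (M.outRate k v)) := by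
  have h0 : (M.compartmentalMatrix k).charmatrix.det ≠ 0 :=
    ((M.compartmentalMatrix k).charpoly_monic).ne_zero
  rw [charmatrix_compartmentalMatrix hM, det_cycleMatrix hM.two_le] at h0
  rw [inputPoly, charmatrix_compartmentalMatrix hM, adjugate_cycleMatrix hM.two_le _ _ h0,
    map_prod]

theorem natDegree_inputPoly_lt (hM : M.IsDirectedCycle) (k : M.Params) (i j : Fin n) :
    (M.inputPoly k i j).natDegree < n := by
  rw [inputPoly_eq_prod hM]
  refine (Polynomial.natDegree_C_mul_le _ _).trans_lt ?_
  rw [Polynomial.natDegree_prod _ _ fun v _ => Polynomial.X_add_C_ne_zero _]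
  simp only [Polynomial.natDegree_X_add_C, Finset.sum_const, smul_eq_mul, mul_one]
  simpa using Finset.card_lt_univ_of_notMem (self_notMem_avoided j i)

theorem coeffMap_eq_iff (hM : M.IsDirectedCycle) {k k' : M.Params} :
    M.coeffMap k = M.coeffMap k' ↔ M.outputPoly k = M.outputPoly k' ∧
      ∀ i ∈ M.Out, ∀ j ∈ M.In, M.inputPoly k i j = M.inputPoly k' i j := by
  constructor
  · intro h
    constructor
    · obtain ⟨i, hi⟩ := M.out_nonempty
      have hdeg : ∀ k : M.Params, (M.outputPoly k).natDegree = n := fun k =>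
        (M.compartmentalMatrix k).charpoly_natDegree_eq_dim.trans (Fintype.card_fin n)
      ext d
      by_cases hd : d < n + 1
      · exact congrFun h (Sum.inl (⟨i, hi⟩, ⟨d, by simpa using hd⟩))
      · rw [Polynomial.coeff_eq_zero_of_natDegree_lt (by rw [hdeg]; omega),
          Polynomial.coeff_eq_zero_of_natDegree_lt (by rw [hdeg]; omega)]
    · intro i hi j hj
      ext d
      by_cases hd : d < n
      · exact congrFun h (Sum.inr (⟨i, hi⟩, ⟨j, hj⟩, ⟨d, by simpa using hd⟩))
      · have := natDegree_inputPoly_lt hM k i j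
        have := natDegree_inputPoly_lt hM k' i j
        rw [Polynomial.coeff_eq_zero_of_natDegree_lt (by omega),
          Polynomial.coeff_eq_zero_of_natDegree_lt (by omega)]
  · rintro ⟨h1, h2⟩
    ext (⟨i, d⟩ | ⟨i, j, d⟩)
    · exact congrArg (fun p : ℝ[X] => p.coeff d) h1
    · exact congrArg (fun p : ℝ[X] => p.coeff d) (h2 i i.2 j j.2)

end Model

/-! ### Generic parameters -/

section Generic

variable {n : ℕ} [NeZero n] (M : LinearCompartmentalModel (Fin n))

/-- The open conditions on a pair of parameter vectors under which equal coefficients force equal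
parameters. They hold near the diagonal at a generic point, and express that the edge rates do
not vanish, that an outgoing rate of `k` can agree with one of `k'` only at the same compartment,
and that a certain root of a polynomial is simple (see `outRate_eq_of_prod_erase_eq`). -/
structure Separated (k k' : M.Params) : Prop where
  left_ne_zero : ∀ v, M.edgeRate k v ≠ 0
  right_ne_zero : ∀ v, M.edgeRate k' v ≠ 0
  outRate_ne : ∀ v w, v ≠ w → M.outRate k v ≠ M.outRate k' w
  prod_erase_ne : ∀ m, ∏ v ∈ Finset.univ.erase m, M.edgeRate k v ≠
    ∏ v ∈ Finset.univ.erase m, (M.outRate k v - M.outRate k' m)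

variable {M}

theorem eventually_separated {k : M.Params} (h : M.Separated k k) :
    ∃ U ∈ 𝓝 k, ∀ k' ∈ U, ∀ k'' ∈ U, M.Separated k' k'' := by
  have ca := continuous_edgeRate (M := M)
  have cd := continuous_outRate (M := M)
  have hev : ∀ᶠ p : M.Params × M.Params in 𝓝 k ×ˢ 𝓝 k, M.Separated p.1 p.2 := by
    rw [← nhds_prod_eq]
    have e1 : ∀ᶠ p : M.Params × M.Params in 𝓝 (k, k), ∀ v, M.edgeRate p.1 v ≠ 0 :=
      Filter.eventually_all.2 fun v =>
        ((ca v).comp continuous_fst).continuousAt.eventually_ne (h.left_ne_zero v)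
    have e2 : ∀ᶠ p : M.Params × M.Params in 𝓝 (k, k), ∀ v, M.edgeRate p.2 v ≠ 0 :=
      Filter.eventually_all.2 fun v =>
        ((ca v).comp continuous_snd).continuousAt.eventually_ne (h.left_ne_zero v)
    have e3 : ∀ᶠ p : M.Params × M.Params in 𝓝 (k, k), ∀ v w, v ≠ w →
        M.outRate p.1 v ≠ M.outRate p.2 w := by
      refine Filter.eventually_all.2 fun v => Filter.eventually_all.2 fun w =>
        Filter.eventually_all.2 fun hvw => ?_
      exact (isOpen_ne_fun ((cd v).comp continuous_fst)
        ((cd w).comp continuous_snd)).eventually_mem (h.outRate_ne v w hvw)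
    have e4 : ∀ᶠ p : M.Params × M.Params in 𝓝 (k, k), ∀ m,
        ∏ v ∈ Finset.univ.erase m, M.edgeRate p.1 v ≠
          ∏ v ∈ Finset.univ.erase m, (M.outRate p.1 v - M.outRate p.2 m) := by
      refine Filter.eventually_all.2 fun m => ?_
      exact (isOpen_ne_fun
        (continuous_finsetProd _ fun v _ => (ca v).comp continuous_fst)
        (continuous_finsetProd _ fun v _ =>
          ((cd v).comp continuous_fst).sub ((cd m).comp continuous_snd))).eventually_mem
        (h.prod_erase_ne m)
    filter_upwards [e1, e2, e3, e4] with p h1 h2 h3 h4 using ⟨h1, h2, h3, h4⟩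
  exact Filter.eventually_prod_self_iff.1 hev

/-- The unit vector of the parameter of the edge `v → v + 1`. -/
def edgeDirection (hM : M.IsDirectedCycle) (v : Fin n) : M.Params :=
  Pi.single (Sum.inl ⟨(v, v + 1), hM.mem_edges.2 rfl⟩) 1

theorem edgeRate_add_smul (hM : M.IsDirectedCycle) (k : M.Params) (t : ℝ) (v w : Fin n) :
    M.edgeRate (k + t • edgeDirection hM v) w = M.edgeRate k w + if w = v then t else 0 := by
  simp [edgeRate, edgeParam, hM.mem_edges, edgeDirection, Pi.single_apply]

theorem outRate_add_smul (hM : M.IsDirectedCycle) (k : M.Params) (t : ℝ) (v w : Fin n) :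
    M.outRate (k + t • edgeDirection hM v) w = M.outRate k w + if w = v then t else 0 := by
  have : M.leakParam (k + t • edgeDirection hM v) w = M.leakParam k w := by
    simp [leakParam, edgeDirection]
  rw [outRate, outRate, edgeRate_add_smul, this, add_assoc]

/-- By Fubini, a measurable condition holds almost everywhere if it holds almost everywhere on
each line in the direction of one edge parameter. -/
theorem ae_of_ae_edgeDirection (hM : M.IsDirectedCycle) (v : Fin n) {p : M.Params → Prop}
    (hp : MeasurableSet {k | p k}) (h : ∀ k, ∀ᵐ t : ℝ, p (k + t • edgeDirection hM v)) :
    ∀ᵐ k : M.Params, p k :=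
  MeasureTheory.ae_mem_of_ae_add_linearMap_mem
    (LinearMap.toSpanSingleton ℝ M.Params (edgeDirection hM v))
    MeasureTheory.volume MeasureTheory.volume hp h

theorem ae_ne_of_finite {s : Set ℝ} (hs : s.Finite) : ∀ᵐ t : ℝ, t ∉ s :=
  MeasureTheory.measure_eq_zero_iff_ae_notMem.1 (hs.measure_zero _)

theorem finite_prod_sub_eq {ι : Type*} (s : Finset ι) (hs : s.Nonempty) (b : ι → ℝ) (c : ℝ) :
    {t : ℝ | c = ∏ v ∈ s, (b v - t)}.Finite := by
  set P : ℝ[X] := ∏ v ∈ s, (Polynomial.C (b v) - Polynomial.X) - Polynomial.C c with hP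
  have hne : ∀ v, Polynomial.C (b v) - Polynomial.X ≠ 0 := fun v h => by
    simpa using congrArg (fun p => Polynomial.coeff p 1) h
  have hdeg : (∏ v ∈ s, (Polynomial.C (b v) - Polynomial.X)).natDegree = s.card := by
    rw [Polynomial.natDegree_prod _ _ fun v _ => hne v, Finset.card_eq_sum_ones]
    refine Finset.sum_congr rfl fun v _ => ?_
    rw [← Polynomial.natDegree_neg, neg_sub, Polynomial.natDegree_X_sub_C]
  have hP0 : P ≠ 0 := by
    intro h
    rw [sub_eq_zero.1 h, Polynomial.natDegree_C] at hdeg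
    exact hs.card_pos.ne hdeg
  refine (Polynomial.finite_setOfPred_isRoot hP0).subset fun t ht => ?_
  simp only [Set.mem_ofPred_eq] at ht
  simp [hP, Polynomial.IsRoot, Polynomial.eval_prod, ← ht]

theorem ae_separated (hM : M.IsDirectedCycle) : ∀ᵐ k : M.Params, M.Separated k k := by
  have ca := continuous_edgeRate (M := M)
  have cd := continuous_outRate (M := M)
  have e1 : ∀ᵐ k : M.Params, ∀ v, M.edgeRate k v ≠ 0 := by
    refine MeasureTheory.ae_all_iff.2 fun v => ?_
    refine ae_of_ae_edgeDirection hM v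
      (isOpen_ne_fun (ca v) continuous_const).measurableSet fun k => ?_
    filter_upwards [ae_ne_of_finite (Set.finite_singleton (-M.edgeRate k v))] with t ht
    rw [edgeRate_add_smul, if_pos rfl]
    exact fun h => ht (eq_neg_of_add_eq_zero_right h)
  have e2 : ∀ᵐ k : M.Params, ∀ v w, v ≠ w → M.outRate k v ≠ M.outRate k w := by
    refine MeasureTheory.ae_all_iff.2 fun v => MeasureTheory.ae_all_iff.2 fun w =>
      MeasureTheory.ae_all_iff.2 fun hvw => ?_
    refine ae_of_ae_edgeDirection hM v (isOpen_ne_fun (cd v) (cd w)).measurableSet fun k => ?_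
    filter_upwards [ae_ne_of_finite (Set.finite_singleton (M.outRate k w - M.outRate k v))]
      with t ht
    rw [outRate_add_smul, outRate_add_smul, if_pos rfl, if_neg hvw.symm, add_zero]
    exact fun h => ht (eq_sub_of_add_eq' h)
  have e3 : ∀ᵐ k : M.Params, ∀ m, ∏ v ∈ Finset.univ.erase m, M.edgeRate k v ≠
      ∏ v ∈ Finset.univ.erase m, (M.outRate k v - M.outRate k m) := by
    refine MeasureTheory.ae_all_iff.2 fun m => ?_
    refine ae_of_ae_edgeDirection hM m (isOpen_ne_fun
      (continuous_finsetProd _ fun v _ => ca v)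
      (continuous_finsetProd _ fun v _ => (cd v).sub (cd m))).measurableSet fun k => ?_
    have hs : (Finset.univ.erase m).Nonempty :=
      ⟨m + 1, Finset.mem_erase.2 ⟨add_one_ne_self hM.two_le m, Finset.mem_univ _⟩⟩
    -- Along this line the left-hand side is constant, and the right-hand side is a nonconstant
    -- polynomial in `t`.
    filter_upwards [ae_ne_of_finite (finite_prod_sub_eq _ hs
      (fun v => M.outRate k v - M.outRate k m) (∏ v ∈ Finset.univ.erase m, M.edgeRate k v))]
      with t ht h
    refine ht ?_
    rw [Finset.prod_congr rfl fun v hv => by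
        rw [edgeRate_add_smul, if_neg (Finset.ne_of_mem_erase hv), add_zero]] at h
    refine h.trans (Finset.prod_congr rfl fun v hv => ?_)
    rw [outRate_add_smul, outRate_add_smul, if_pos rfl, if_neg (Finset.ne_of_mem_erase hv)]
    ring
  filter_upwards [e1, e2, e3] with k h1 h2 h3 using ⟨h1, h1, h2, h3⟩

end Generic

/-! ### Consecutive leaks -/

section Interlacing

variable {n : ℕ}

/-- The stretches between cyclically consecutive terms of an increasing sequence cover `Fin n`.
On a stretch that does not wrap around, no term lies strictly inside; on the one that does,
no term lies outside the interval between its two ends. -/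
theorem exists_mem_stretch {z : ℕ} (hz : 2 ≤ z) (f : Fin z ↪o Fin n) (s : Fin n) :
    ∃ α : Fin z, s ∈ stretch (f α) (f (finRotate z α)) ∧
      ((f α < f (finRotate z α) ∧ ∀ β, f β ≤ f α ∨ f (finRotate z α) ≤ f β) ∨
        (f (finRotate z α) < f α ∧ ∀ β, f (finRotate z α) ≤ f β ∧ f β ≤ f α)) := by
  obtain ⟨k, rfl⟩ : ∃ k, z = k + 1 := ⟨z - 1, by omega⟩
  have hlast : finRotate (k + 1) (Fin.last k) = 0 := finRotate_last
  have hlt : f 0 < f (Fin.last k) := f.lt_iff_lt.2 (by simp [Fin.lt_def]; omega)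
  have hend : ∀ β, f 0 ≤ f β ∧ f β ≤ f (Fin.last k) := fun β =>
    ⟨f.le_iff_le.2 (Fin.zero_le β), f.le_iff_le.2 (Fin.le_last β)⟩
  have wrap : f (Fin.last k) < s ∨ s ≤ f 0 → ∃ α : Fin (k + 1),
      s ∈ stretch (f α) (f (finRotate (k + 1) α)) ∧
      ((f α < f (finRotate (k + 1) α) ∧ ∀ β, f β ≤ f α ∨ f (finRotate (k + 1) α) ≤ f β) ∨
        (f (finRotate (k + 1) α) < f α ∧ ∀ β, f (finRotate (k + 1) α) ≤ f β ∧ f β ≤ f α)) := by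
    intro h
    refine ⟨Fin.last k, ?_, Or.inr ?_⟩
    · rw [hlast, stretch, if_neg hlt.not_gt]
      simpa using h
    · rw [hlast]
      exact ⟨hlt, hend⟩
  by_cases h0 : s ≤ f 0
  · exact wrap (Or.inr h0)
  -- Otherwise `s` lies in the stretch that starts at the last term before `s`.
  obtain ⟨α, hα, hmax⟩ := (Finset.univ.filter fun α => f α < s).exists_max_image id
    ⟨0, by simpa using h0⟩
  simp only [Finset.mem_filter_univ, id] at hα hmax
  rcases (Fin.le_last α).eq_or_lt with rfl | hαlt
  · exact wrap (Or.inl hα)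
  have hval : (finRotate (k + 1) α).val = α.val + 1 := by
    rw [finRotate_apply]
    exact Fin.val_add_one_of_lt hαlt
  have hnext : f α < f (finRotate (k + 1) α) := f.lt_iff_lt.2 (by rw [Fin.lt_def, hval]; omega)
  refine ⟨α, ?_, Or.inl ⟨hnext, fun β => ?_⟩⟩
  · rw [stretch, if_pos hnext, Finset.mem_Ioc]
    refine ⟨hα, not_lt.1 fun h => ?_⟩
    have := hmax _ h
    rw [Fin.le_def, hval] at this
    omega
  · rw [f.le_iff_le, f.le_iff_le, Fin.le_def, Fin.le_def, hval]
    omega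

theorem prod_Iio_mul_prod_Ico (r : Fin n → ℝ) {i j : Fin n} (h : i ≤ j) :
    (∏ v ∈ Finset.Iio i, r v) * ∏ v ∈ Finset.Ico i j, r v = ∏ v ∈ Finset.Iio j, r v := by
  rw [← Finset.prod_union]
  · refine Finset.prod_congr ?_ fun _ _ => rfl
    ext v
    simp only [Finset.mem_union, Finset.mem_Iio, Finset.mem_Ico, Fin.lt_def, Fin.le_def] at h ⊢
    omega
  · rw [Finset.disjoint_left]
    simp only [Finset.mem_Iio, Finset.mem_Ico, Fin.lt_def, Fin.le_def]
    omega

theorem prod_Iio_mul_prod_Ici (r : Fin n → ℝ) (i : Fin n) :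
    (∏ v ∈ Finset.Iio i, r v) * ∏ v ∈ Finset.Ici i, r v = ∏ v, r v := by
  rw [← Finset.prod_union]
  · refine Finset.prod_congr ?_ fun _ _ => rfl
    ext v
    simp only [Finset.mem_union, Finset.mem_Iio, Finset.mem_Ici, Fin.lt_def, Fin.le_def,
      Finset.mem_univ, iff_true]
    omega
  · rw [Finset.disjoint_left]
    simp only [Finset.mem_Iio, Finset.mem_Ici, Fin.lt_def, Fin.le_def]
    omega

/-- If the total product is `1`, then the product over the path from `j` to `i` is the quotient
of two partial products, whether or not the path wraps around. -/
theorem prod_Iio_eq_of_prod_passed_eq_one {r : Fin n → ℝ} (h0 : ∀ v, r v ≠ 0)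
    (h1 : ∏ v, r v = 1) {i j : Fin n} (h : ∏ v ∈ passed j i, r v = 1) :
    ∏ v ∈ Finset.Iio i, r v = ∏ v ∈ Finset.Iio j, r v := by
  rcases le_or_gt j i with hji | hij
  · have hp : passed j i = Finset.Ico j i := by
      ext v
      simp only [mem_passed, Finset.mem_Ico, Fin.lt_def, Fin.le_def] at hji ⊢
      omega
    rw [← prod_Iio_mul_prod_Ico r hji, ← hp, h, mul_one]
  · have hp : passed j i = Finset.Iio i ∪ Finset.Ici j := by
      ext v
      simp only [mem_passed, Finset.mem_union, Finset.mem_Iio, Finset.mem_Ici, Fin.lt_def,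
        Fin.le_def] at hij ⊢
      omega
    have hd : Disjoint (Finset.Iio i) (Finset.Ici j) := by
      rw [Finset.disjoint_left]
      simp only [Finset.mem_Iio, Finset.mem_Ici, Fin.lt_def, Fin.le_def] at hij ⊢
      omega
    rw [hp, Finset.prod_union hd, ← h1, ← prod_Iio_mul_prod_Ici r j] at h
    exact mul_right_cancel₀ (Finset.prod_ne_zero_iff.2 fun v _ => h0 v) h

variable [NeZero n] {M : LinearCompartmentalModel (Fin n)}

/-- A function supported (multiplicatively) on the leaks whose product over the whole cycle and
over each path from an input to an output is `1` is trivial, if the leaks are interlaced with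
the inputs and outputs. Its partial products take one value at all inputs and outputs, and are
constant on each stretch between consecutive leaks. -/
theorem eq_one_of_interlacing
    (hI : M.Leak.card ≤ 1 ∨ (2 ≤ M.Leak.card ∧ ∀ α : Fin M.Leak.card,
      (stretch (M.leakAt α) (M.leakAt (finRotate M.Leak.card α)) ∩ (M.In ∪ M.Out)).Nonempty))
    {r : Fin n → ℝ} (h0 : ∀ v, r v ≠ 0) (h1 : ∏ v, r v = 1) (hr : ∀ v ∉ M.Leak, r v = 1)
    (hp : ∀ i ∈ M.Out, ∀ j ∈ M.In, ∏ v ∈ passed j i, r v = 1) (v : Fin n) : r v = 1 := by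
  rcases hI with hz | ⟨hz, hI⟩
  · by_cases hv : v ∈ M.Leak
    · rw [← h1, Fintype.prod_eq_single v]
      intro w hw
      exact hr w fun hwL => hw (Finset.card_le_one.1 hz w hwL v hv)
    · exact hr v hv
  set G : Fin n → ℝ := fun s => ∏ v ∈ Finset.Iio s, r v with hG
  have hG0 : ∀ s, G s ≠ 0 := fun s => Finset.prod_ne_zero_iff.2 fun v _ => h0 v
  obtain ⟨i₀, hi₀⟩ := M.out_nonempty
  obtain ⟨j₀, hj₀⟩ := M.in_nonempty
  have hGio : ∀ i ∈ M.Out, ∀ j ∈ M.In, G i = G j := fun i hi j hj =>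
    prod_Iio_eq_of_prod_passed_eq_one h0 h1 (hp i hi j hj)
  have hGS : ∀ s ∈ M.In ∪ M.Out, G s = G i₀ := by
    intro s hs
    rcases Finset.mem_union.1 hs with hs | hs
    · exact (hGio i₀ hi₀ s hs).symm
    · rw [hGio s hs j₀ hj₀, hGio i₀ hi₀ j₀ hj₀]
  have hrange : ∀ v ∈ M.Leak, ∃ β, M.leakAt β = v := fun v hv => by
    have := Finset.range_orderEmbOfFin M.Leak rfl
    exact (Set.ext_iff.1 this v).2 hv
  have hGall : ∀ s, G s = G i₀ := by
    intro s
    obtain ⟨α, hs, hα⟩ := exists_mem_stretch hz M.leakAt s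
    obtain ⟨t, ht⟩ := hI α
    rw [Finset.mem_inter] at ht
    rw [← hGS t ht.2]
    rcases hα with ⟨hlt, hα⟩ | ⟨hlt, hα⟩
    · have hconst : ∀ s ∈ stretch (M.leakAt α) (M.leakAt (finRotate _ α)),
          G s = G (M.leakAt (finRotate _ α)) := by
        intro s hs
        rw [stretch, if_pos hlt, Finset.mem_Ioc] at hs
        rw [hG]
        simp only
        rw [← prod_Iio_mul_prod_Ico r hs.2, Finset.prod_eq_one (s := Finset.Ico _ _), mul_one]
        intro v hv
        rw [Finset.mem_Ico] at hv
        refine hr v fun hvL => ?_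
        obtain ⟨β, rfl⟩ := hrange v hvL
        rcases hα β with h | h
        · exact absurd (hs.1.trans_le hv.1) h.not_gt
        · exact absurd hv.2 h.not_gt
      rw [hconst s hs, hconst t ht.1]
    · have hconst : ∀ s ∈ stretch (M.leakAt α) (M.leakAt (finRotate _ α)), G s = 1 := by
        intro s hs
        rw [stretch, if_neg hlt.not_gt, Finset.mem_union, Finset.mem_Ioi, Finset.mem_Iic] at hs
        rcases hs with hs | hs
        · rw [← h1, ← prod_Iio_mul_prod_Ici r s, Finset.prod_eq_one (s := Finset.Ici _), mul_one]
          intro v hv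
          rw [Finset.mem_Ici] at hv
          refine hr v fun hvL => ?_
          obtain ⟨β, rfl⟩ := hrange v hvL
          exact absurd (hs.trans_le hv) (hα β).2.not_gt
        · refine Finset.prod_eq_one fun v hv => ?_
          rw [Finset.mem_Iio] at hv
          refine hr v fun hvL => ?_
          obtain ⟨β, rfl⟩ := hrange v hvL
          exact absurd (hv.trans_le hs) (hα β).1.not_gt
      rw [hconst s hs, hconst t ht.1]
  by_cases hv : v.val + 1 = n
  · have hG0' : G 0 = 1 := Finset.prod_eq_one fun w hw => by
      simp at hw
    have hIci : Finset.Ici v = {v} := by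
      ext w
      have := w.isLt
      simp only [Finset.mem_Ici, Finset.mem_singleton, Fin.le_def, Fin.ext_iff]
      omega
    have := prod_Iio_mul_prod_Ici r v
    rw [hIci, Finset.prod_singleton, h1] at this
    change G v * r v = 1 at this
    rwa [hGall v, ← hGall 0, hG0', one_mul] at this
  · have hval : (v + 1).val = v.val + 1 := by rw [val_add_one_eq_ite, if_neg hv]
    have hIco : Finset.Ico v (v + 1) = {v} := by
      ext w
      simp only [Finset.mem_Ico, Finset.mem_singleton, Fin.le_def, Fin.lt_def, Fin.ext_iff, hval]
      omega
    have := prod_Iio_mul_prod_Ico r (i := v) (j := v + 1) (by rw [Fin.le_def, hval]; omega)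
    rw [hIco, Finset.prod_singleton] at this
    change G v * r v = G (v + 1) at this
    rw [hGall (v + 1), ← hGall v] at this
    exact mul_eq_left₀ (hG0 v) |>.1 this

/-- If `In = {m + 1}` and `Out = {m}`, then `eq_one_of_interlacing` excludes two leaks off `m`, since
the only path passes all compartments but `m`. The remaining models with two leaks are
exceptional. -/
theorem leak_card_le_one_of_adjacent (hI : M.IsLeakInterlacing) {m : Fin n}
    (hIn : M.In = {m + 1}) (hOut : M.Out = {m}) : M.Leak.card ≤ 1 := by
  by_contra hcard
  push Not at hcard
  have hcard' : 1 < (M.Leak.erase m).card := by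
    by_contra! hle
    have hmem : m ∈ M.Leak := by
      by_contra hm
      rw [Finset.erase_eq_of_notMem hm] at hle
      omega
    rw [Finset.card_erase_of_mem hmem] at hle
    exact hI.1 ⟨m + 1, hIn, by simpa using hOut, by omega, by simpa using hmem⟩
  obtain ⟨l, hl, l', hl', hne⟩ := Finset.one_lt_card.1 hcard'
  rw [Finset.mem_erase] at hl hl'
  -- The function `2` at `l` and `1 / 2` at `l'` contradicts `eq_one_of_interlacing`.
  set r : Fin n → ℝ := Pi.mulSingle l 2 * Pi.mulSingle l' (1 / 2) with hr
  have hr1 : r l = 2 := by simp [hr, Pi.mulSingle_eq_of_ne hne]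
  have hr2 : r l' = 1 / 2 := by simp [hr, Pi.mulSingle_eq_of_ne hne.symm]
  have hr3 : ∀ v, v ≠ l → v ≠ l' → r v = 1 := fun v h h' => by
    simp [hr, Pi.mulSingle_eq_of_ne h, Pi.mulSingle_eq_of_ne h']
  have h1 : ∏ v, r v = 1 := by
    rw [Fintype.prod_eq_mul l l' hne fun v hv => hr3 v hv.1 hv.2, hr1, hr2]
    norm_num
  have := eq_one_of_interlacing hI.2 (r := r) ?_ h1 ?_ ?_ l
  · rw [hr1] at this
    norm_num at this
  · intro v
    by_cases h : v = l
    · rw [h, hr1]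
      norm_num
    by_cases h' : v = l'
    · rw [h', hr2]
      norm_num
    rw [hr3 v h h']
    norm_num
  · intro v hv
    exact hr3 v (fun h => hv (h ▸ hl.2)) fun h => hv (h ▸ hl'.2)
  · intro i hi j hj
    rw [hOut, Finset.mem_singleton] at hi
    rw [hIn, Finset.mem_singleton] at hj
    rw [hi, hj, passed_of_add_one_eq rfl, Finset.prod_erase _ (hr3 m hl.1.symm hl'.1.symm), h1]

end Interlacing

/-! ### Leak-interlacing models are identifiable -/

section Identifiable

variable {n : ℕ} [NeZero n] {M : LinearCompartmentalModel (Fin n)}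

theorem prod_add_outRate_sub_eq (hM : M.IsDirectedCycle) {k k' : M.Params}
    (h : M.outputPoly k = M.outputPoly k') (x : ℝ) :
    ∏ v, (x + M.outRate k v) - ∏ v, M.edgeRate k v =
      ∏ v, (x + M.outRate k' v) - ∏ v, M.edgeRate k' v := by
  simpa [outputPoly_eq_prod hM, Polynomial.eval_prod] using congrArg (Polynomial.eval x) h

/-- If `k` and `k'` are separated, a root of a product that belongs to `k` must be the root of the
product that belongs to `k'` with the same index. -/
theorem outRate_eq_of_prod_eq_zero {k k' : M.Params} (hs : M.Separated k k') (s : Finset (Fin n))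
    {v : Fin n} (h : ∏ w ∈ s, (-M.outRate k v + M.outRate k' w) = 0) :
    M.outRate k v = M.outRate k' v := by
  obtain ⟨w, -, hw⟩ := Finset.prod_eq_zero_iff.1 h
  have hw' := neg_add_eq_zero.1 hw
  by_cases hvw : v = w
  · rwa [← hvw] at hw'
  · exact absurd hw' (hs.outRate_ne v w hvw)

/-- One common outgoing rate `d` yields the product of the edge rates, as minus the value of the
output polynomial at `-d`; then all roots of the shifted output polynomial are known. -/
theorem rates_eq_of_outRate_eq (hM : M.IsDirectedCycle) {k k' : M.Params} (hs : M.Separated k k')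
    (h : M.outputPoly k = M.outputPoly k') {v : Fin n} (hv : M.outRate k v = M.outRate k' v) :
    M.outRate k = M.outRate k' ∧ ∏ v, M.edgeRate k v = ∏ v, M.edgeRate k' v := by
  have hzero : ∀ (k : M.Params) (v : Fin n), ∏ w, (-M.outRate k v + M.outRate k w) = 0 :=
    fun k v => Finset.prod_eq_zero (Finset.mem_univ v) (neg_add_cancel _)
  have hc : ∏ v, M.edgeRate k v = ∏ v, M.edgeRate k' v := by
    have := prod_add_outRate_sub_eq hM h (-M.outRate k v)
    rw [hzero, hv, hzero] at this
    linarith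
  refine ⟨funext fun w => ?_, hc⟩
  have := prod_add_outRate_sub_eq hM h (-M.outRate k w)
  rw [hzero, hc, sub_left_inj] at this
  exact outRate_eq_of_prod_eq_zero hs _ this.symm

/-- A compartment off the path from an input to an output has its outgoing rate as a root
of an input polynomial. -/
theorem outRate_eq_of_mem_avoided (hM : M.IsDirectedCycle) {k k' : M.Params}
    (hs : M.Separated k k') {i j v : Fin n} (hv : v ∈ avoided j i)
    (h : M.inputPoly k i j = M.inputPoly k' i j) : M.outRate k v = M.outRate k' v := by
  have := congrArg (Polynomial.eval (-M.outRate k v)) h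
  simp only [inputPoly_eq_prod hM, Polynomial.eval_mul, Polynomial.eval_C, Polynomial.eval_prod,
    Polynomial.eval_add, Polynomial.eval_X] at this
  rw [Finset.prod_eq_zero hv (neg_add_cancel _), mul_zero] at this
  exact outRate_eq_of_prod_eq_zero hs _ ((mul_eq_zero.1 this.symm).resolve_left
    (Finset.prod_ne_zero_iff.2 fun w _ => hs.right_ne_zero w))

theorem prod_passed_eq (hM : M.IsDirectedCycle) {k k' : M.Params} {i j : Fin n}
    (hd : ∀ v ∈ avoided j i, M.outRate k v = M.outRate k' v)
    (h : M.inputPoly k i j = M.inputPoly k' i j) :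
    ∏ v ∈ passed j i, M.edgeRate k v = ∏ v ∈ passed j i, M.edgeRate k' v := by
  have hprod : ∏ v ∈ avoided j i, (Polynomial.X + Polynomial.C (M.outRate k v)) =
      ∏ v ∈ avoided j i, (Polynomial.X + Polynomial.C (M.outRate k' v)) :=
    Finset.prod_congr rfl fun v hv => by rw [hd v hv]
  rw [inputPoly_eq_prod hM, inputPoly_eq_prod hM, hprod] at h
  exact Polynomial.C_injective (mul_right_cancel₀
    (Finset.prod_ne_zero_iff.2 fun v _ => Polynomial.X_add_C_ne_zero _) h)

/-- With at most one leak, the output polynomial `Q` and `C = ∏_{v ≠ m} a v` yield a polynomial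
in `t` that vanishes at `t = d m`: this is `Q (-t) + t * C` if `m` has no leak, and
`Q (-t) - Q 0 + t * C` if `m` is the only leak. Both equal
`(t - d m) * (C - ∏_{v ≠ m} (d v - t))`, and separatedness keeps the second factor from vanishing
at a second candidate for `d m`. -/
theorem outRate_eq_of_prod_erase_eq (hM : M.IsDirectedCycle) (hL : M.Leak.card ≤ 1)
    {k k' : M.Params} (hs : M.Separated k k') (h : M.outputPoly k = M.outputPoly k') (m : Fin n)
    (hC : ∏ v ∈ Finset.univ.erase m, M.edgeRate k v =
      ∏ v ∈ Finset.univ.erase m, M.edgeRate k' v) :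
    M.outRate k m = M.outRate k' m := by
  have hm := Finset.mem_univ m
  have hQ := prod_add_outRate_sub_eq hM h (-M.outRate k' m)
  rw [Finset.prod_eq_zero (f := fun v => -M.outRate k' m + M.outRate k' v) hm
    (neg_add_cancel _), ← Finset.mul_prod_erase _ _ hm] at hQ
  have key : (M.outRate k' m - M.outRate k m) *
      (∏ v ∈ Finset.univ.erase m, M.edgeRate k v -
        ∏ v ∈ Finset.univ.erase m, (M.outRate k v - M.outRate k' m)) = 0 := by
    simp only [neg_add_eq_sub] at hQ
    by_cases hmL : m ∈ M.Leak
    · have hprod : ∀ k : M.Params, ∏ v, M.outRate k v =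
          M.outRate k m * ∏ v ∈ Finset.univ.erase m, M.edgeRate k v := fun k => by
        rw [← Finset.mul_prod_erase _ _ hm]
        congr 1
        refine Finset.prod_congr rfl fun v hv => outRate_eq_edgeRate k fun hvL => ?_
        exact Finset.ne_of_mem_erase hv (Finset.card_le_one.1 hL v hvL m hmL)
      have hQ0 := prod_add_outRate_sub_eq hM h 0
      simp only [zero_add] at hQ0
      rw [hprod, hprod, ← hC] at hQ0
      linear_combination hQ - hQ0
    · rw [← Finset.mul_prod_erase _ (M.edgeRate k) hm, ← Finset.mul_prod_erase _ (M.edgeRate k') hm,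
        ← hC, ← outRate_eq_edgeRate k hmL, ← outRate_eq_edgeRate k' hmL] at hQ
      linear_combination hQ
  rcases mul_eq_zero.1 key with h | h
  · exact (sub_eq_zero.1 h).symm
  · exact absurd (sub_eq_zero.1 h) (hs.prod_erase_ne m)

theorem rates_eq (hM : M.IsDirectedCycle) (hI : M.IsLeakInterlacing) {k k' : M.Params}
    (hs : M.Separated k k') (h : M.coeffMap k = M.coeffMap k') :
    M.outRate k = M.outRate k' ∧ ∏ v, M.edgeRate k v = ∏ v, M.edgeRate k' v := by
  obtain ⟨hout, hin⟩ := (coeffMap_eq_iff hM).1 h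
  by_cases hadj : ∃ i ∈ M.Out, ∃ j ∈ M.In, i + 1 ≠ j
  · obtain ⟨i, hi, j, hj, hij⟩ := hadj
    exact rates_eq_of_outRate_eq hM hs hout
      (outRate_eq_of_mem_avoided hM hs (add_one_mem_avoided hij) (hin i hi j hj))
  · push Not at hadj
    obtain ⟨m, hm⟩ := M.out_nonempty
    obtain ⟨j, hj⟩ := M.in_nonempty
    obtain rfl := hadj m hm j hj
    have hIn : M.In = {m + 1} :=
      Finset.eq_singleton_iff_unique_mem.2 ⟨hj, fun j' hj' => (hadj m hm j' hj').symm⟩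
    have hOut : M.Out = {m} := Finset.eq_singleton_iff_unique_mem.2
      ⟨hm, fun i hi => add_right_cancel (hadj i hi _ hj)⟩
    have hC := prod_passed_eq hM (by simp [avoided_of_add_one_eq rfl]) (hin m hm _ hj)
    rw [passed_of_add_one_eq rfl] at hC
    exact rates_eq_of_outRate_eq hM hs hout (outRate_eq_of_prod_erase_eq hM
      (leak_card_le_one_of_adjacent hI hIn hOut) hs hout m hC)

theorem eq_of_coeffMap_eq (hM : M.IsDirectedCycle) (hI : M.IsLeakInterlacing) {k k' : M.Params}
    (hs : M.Separated k k') (h : M.coeffMap k = M.coeffMap k') : k = k' := by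
  obtain ⟨hd, hc⟩ := rates_eq hM hI hs h
  refine params_ext hM (funext fun v => ?_) hd
  have hdiv : ∀ s : Finset (Fin n), ∏ v ∈ s, M.edgeRate k v = ∏ v ∈ s, M.edgeRate k' v →
      ∏ v ∈ s, M.edgeRate k v / M.edgeRate k' v = 1 := fun s hs' => by
    rw [Finset.prod_div_distrib, hs',
      div_self (Finset.prod_ne_zero_iff.2 fun v _ => hs.right_ne_zero v)]
  refine (div_eq_one_iff_eq (hs.right_ne_zero v)).1 (eq_one_of_interlacing hI.2
    (r := fun v => M.edgeRate k v / M.edgeRate k' v)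
    (fun v => div_ne_zero (hs.left_ne_zero v) (hs.right_ne_zero v)) (hdiv _ hc)
    (fun v hv => ?_) (fun i hi j hj => ?_) v)
  · rw [div_eq_one_iff_eq (hs.right_ne_zero v), ← outRate_eq_edgeRate k hv,
      ← outRate_eq_edgeRate k' hv, hd]
  · exact hdiv _ (prod_passed_eq hM (fun v _ => congrFun hd v)
      (((coeffMap_eq_iff hM).1 h).2 i hi j hj))

theorem IsLeakInterlacing.genericallyLocallyIdentifiable (hM : M.IsDirectedCycle)
    (hI : M.IsLeakInterlacing) : M.GenericallyLocallyIdentifiable := by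
  filter_upwards [ae_separated hM] with k hk
  obtain ⟨U, hU, hsep⟩ := eventually_separated hk
  exact ⟨U, hU, fun k' hk' k'' hk'' h => eq_of_coeffMap_eq hM hI (hsep k' hk' k'' hk'') h⟩

end Identifiable

/-! ### Real roots of perturbed polynomials -/

/-- A polynomial with simple real roots still splits over `ℝ`, with nearby roots, after a small
change of its constant term: its values on the two sides of each root keep their opposite signs. -/
theorem eventually_exists_prod_X_add_C_eq {ι : Type*} [Fintype ι] [Nonempty ι]
    {d : ι → ℝ} (hd : Function.Injective d) {W : Set (ι → ℝ)} (hW : W ∈ 𝓝 d) :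
    ∀ᶠ h in 𝓝 (0 : ℝ), ∃ d' ∈ W, ∏ i, (Polynomial.X + Polynomial.C (d' i)) =
      ∏ i, (Polynomial.X + Polynomial.C (d i)) + Polynomial.C h := by
  classical
  obtain ⟨ε₀, hε₀, hball⟩ := Metric.mem_nhds_iff.1 hW
  have hsmall : ∀ᶠ ε in 𝓝[>] (0 : ℝ), ε < ε₀ ∧ ∀ v w, v ≠ w → 2 * ε < |d v - d w| := by
    refine Filter.Eventually.filter_mono nhdsWithin_le_nhds
      ((eventually_lt_nhds hε₀).and ?_)
    refine Filter.eventually_all.2 fun v => Filter.eventually_all.2 fun w =>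
      Filter.eventually_all.2 fun hvw => ?_
    have hpos : 0 < |d v - d w| / 2 := half_pos (abs_pos.2 (sub_ne_zero.2 (hd.ne hvw)))
    filter_upwards [eventually_lt_nhds hpos] with ε hε
    linarith
  obtain ⟨ε, ⟨hεε₀, hsep⟩, hε⟩ := (hsmall.and self_mem_nhdsWithin).exists
  replace hε : 0 < ε := hε
  set f : ℝ → ℝ := fun x => ∏ v, (x + d v) with hf
  have hfc : Continuous f := by fun_prop
  have hsign : ∀ i, f (-d i + ε) * f (-d i - ε) < 0 := fun i => by
    rw [hf]
    simp only
    rw [← Finset.prod_mul_distrib, ← Finset.mul_prod_erase _ _ (Finset.mem_univ i)]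
    refine mul_neg_of_neg_of_pos (by nlinarith) (Finset.prod_pos fun v hv => ?_)
    have h1 := hsep v i (Finset.ne_of_mem_erase hv)
    have h2 : ε ^ 2 < (d v - d i) ^ 2 := by
      rw [← sq_abs (d v - d i)]
      exact pow_lt_pow_left₀ (by linarith) hε.le two_ne_zero
    nlinarith
  have hev : ∀ᶠ h in 𝓝 (0 : ℝ), ∀ i, (f (-d i + ε) + h) * (f (-d i - ε) + h) < 0 := by
    refine Filter.eventually_all.2 fun i => ?_
    have hc : Continuous fun h : ℝ => (f (-d i + ε) + h) * (f (-d i - ε) + h) := by fun_prop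
    exact (isOpen_Iio.preimage hc).eventually_mem (by simpa using hsign i)
  filter_upwards [hev] with h hh
  have hroot : ∀ i, ∃ y, |y - d i| ≤ ε ∧ f (-y) + h = 0 := by
    intro i
    have hmem : (0 : ℝ) ∈ Set.uIcc (f (-d i - ε) + h) (f (-d i + ε) + h) := by
      rw [Set.mem_uIcc]
      rcases mul_neg_iff.1 (hh i) with h' | h'
      · exact Or.inl ⟨h'.2.le, h'.1.le⟩
      · exact Or.inr ⟨h'.1.le, h'.2.le⟩
    obtain ⟨x, hx, hx0⟩ := intermediate_value_uIcc (f := fun x => f x + h) (by fun_prop) hmem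
    rw [Set.uIcc_of_le (by linarith), Set.mem_Icc] at hx
    exact ⟨-x, abs_le.2 ⟨by linarith, by linarith⟩, by simpa using hx0⟩
  choose d' hd' hzero using hroot
  have hinj : Function.Injective d' := by
    intro v w hvw
    by_contra hne
    have h1 := hsep v w hne
    have h2 := hd' v
    have h3 := hd' w
    rw [hvw, abs_sub_comm] at h2
    have := abs_sub_le (d v) (d' w) (d w)
    linarith
  refine ⟨d', hball ?_, ?_⟩
  · rw [Metric.mem_ball, dist_pi_lt_iff hε₀]
    exact fun i => (hd' i).trans_lt hεε₀
  · have hmonic : ∀ d : ι → ℝ, (∏ i, (Polynomial.X + Polynomial.C (d i))).Monic := fun d =>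
      Polynomial.monic_prod_of_monic _ _ fun i _ => Polynomial.monic_X_add_C _
    have hdeg : ∀ d : ι → ℝ,
        (∏ i, (Polynomial.X + Polynomial.C (d i))).degree = (Fintype.card ι : WithBot ℕ) := fun d => by
      simp [Polynomial.degree_prod, Polynomial.degree_X_add_C]
    have hlt : (Polynomial.C h).degree < (∏ i, (Polynomial.X + Polynomial.C (d i))).degree := by
      rw [hdeg]
      exact Polynomial.degree_C_le.trans_lt (by exact_mod_cast Fintype.card_pos)
    refine Polynomial.eq_of_degree_sub_lt_of_eval_index_eq (s := Finset.univ)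
      (v := fun i => -d' i) (fun v _ w _ hvw => hinj (neg_injective hvw)) ?_ fun i _ => ?_
    · rw [Finset.card_univ, ← hdeg d']
      refine Polynomial.degree_sub_lt_left ?_ (hmonic d').ne_zero ?_
      · rw [Polynomial.degree_add_eq_left_of_degree_lt hlt, hdeg, hdeg]
      · rw [(hmonic d').leadingCoeff, ((hmonic d).add_of_left hlt).leadingCoeff]
    · have h1 : ∏ v, (-d' i + d' v) = 0 :=
        Finset.prod_eq_zero (Finset.mem_univ i) (neg_add_cancel _)
      simpa [Polynomial.eval_prod, h1] using (hzero i).symm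

/-! ### Models that are not leak-interlacing are not identifiable -/

section NotIdentifiable

variable {n : ℕ}

theorem mem_passed_iff_of_disjoint_stretch {l l' : Fin n} (hne : l ≠ l') {i j : Fin n}
    (hi : i ∉ stretch l l') (hj : j ∉ stretch l l') : l ∈ passed j i ↔ l' ∈ passed j i := by
  have hne' := Fin.val_ne_of_ne hne
  unfold stretch at hi hj
  split_ifs at hi hj with h <;>
  simp only [Finset.mem_Ioc, Finset.mem_union, Finset.mem_Ioi, Finset.mem_Iic, mem_passed,
    Fin.lt_def, Fin.le_def] at * <;>
  omega

variable [NeZero n] {M : LinearCompartmentalModel (Fin n)}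

/-- If each path from an input to an output passes both of the leaks `l` and `l'` or neither, then
scaling the edge rate of `l` by `t` and that of `l'` by `1 / t`, with all outgoing rates fixed, does
not change the coefficients. -/
theorem not_injOn_of_mem_passed_iff (hM : M.IsDirectedCycle) {l l' : Fin n} (hl : l ∈ M.Leak)
    (hl' : l' ∈ M.Leak) (hne : l ≠ l')
    (hp : ∀ i ∈ M.Out, ∀ j ∈ M.In, l ∈ passed j i ↔ l' ∈ passed j i) {k : M.Params}
    (hk : M.edgeRate k l ≠ 0) {U : Set M.Params} (hU : U ∈ 𝓝 k) : ¬ U.InjOn M.coeffMap := by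
  intro hinj
  set ρ : ℝ → Fin n → ℝ := fun t => Pi.mulSingle l t * Pi.mulSingle l' t⁻¹ with hρ
  set p : ℝ → M.Params := fun t => M.ofRates (M.edgeRate k * ρ t) (M.outRate k) with hpdef
  have hp1 : p 1 = k := by
    simp [hpdef, hρ, ofRates_edgeRate_outRate hM]
  have hcont : ContinuousAt p 1 := by
    refine (continuous_ofRates M).continuousAt.comp
      (f := fun t => (M.edgeRate k * ρ t, M.outRate k)) ?_
    refine ContinuousAt.prodMk (continuousAt_pi.2 fun v => ?_) continuousAt_const
    simp only [hρ, Pi.mul_apply, Pi.mulSingle_apply]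
    split_ifs <;> fun_prop (disch := norm_num)
  have hev : ∀ᶠ t in 𝓝[≠] (1 : ℝ), p t ∈ U ∧ t ≠ 0 ∧ t ≠ 1 := by
    refine Filter.Eventually.and ?_ (Filter.Eventually.and ?_ self_mem_nhdsWithin)
    · exact (hcont.eventually_mem (by rwa [hp1])).filter_mono nhdsWithin_le_nhds
    · exact (eventually_ne_nhds one_ne_zero).filter_mono nhdsWithin_le_nhds
  obtain ⟨t, htU, ht0, ht1⟩ := hev.exists
  have hd : M.outRate (p t) = M.outRate k := by
    refine outRate_ofRates hM fun v hv => ?_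
    have h1 : v ≠ l := fun h => hv (h ▸ hl)
    have h2 : v ≠ l' := fun h => hv (h ▸ hl')
    simp [hρ, h1, h2, outRate_eq_edgeRate k hv]
  have ha : M.edgeRate (p t) = M.edgeRate k * ρ t := edgeRate_ofRates hM _ _
  have hprod : ∀ s : Finset (Fin n), (l ∈ s ↔ l' ∈ s) →
      ∏ v ∈ s, M.edgeRate (p t) v = ∏ v ∈ s, M.edgeRate k v := by
    intro s hs
    rw [ha]
    simp only [hρ, Pi.mul_apply, Pi.mulSingle_apply, Finset.prod_mul_distrib,
      Finset.prod_ite_eq', hs]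
    split_ifs
    · rw [mul_inv_cancel₀ ht0, mul_one]
    · rw [mul_one, mul_one]
  have hcoeff : M.coeffMap (p t) = M.coeffMap k := by
    refine (coeffMap_eq_iff hM).2 ⟨?_, fun i hi j hj => ?_⟩
    · rw [outputPoly_eq_prod hM, outputPoly_eq_prod hM, hd, hprod _ (by simp)]
    · rw [inputPoly_eq_prod hM, inputPoly_eq_prod hM, hd, hprod _ (hp i hi j hj)]
  have hpk := congrFun (ha.symm.trans (congrArg M.edgeRate
    (hinj htU (mem_of_mem_nhds hU) hcoeff))) l
  simp only [hρ, Pi.mul_apply, Pi.mulSingle_eq_same, Pi.mulSingle_eq_of_ne hne, mul_one] at hpk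
  exact ht1 ((mul_eq_left₀ hk).1 hpk)

/-- In an exceptional model the constant term of the output polynomial can be traded against the
edge rate of the output compartment `m`: change `∏ a` by `h`, take for the outgoing rates the
roots of the output polynomial shifted accordingly, and use the edge rate of the second leak
`l` to keep `∏_{v ≠ m} a v` fixed. -/
theorem not_injOn_of_isExceptional (hM : M.IsDirectedCycle) {m l : Fin n} (hIn : M.In = {m + 1})
    (hOut : M.Out = {m}) (hL : M.Leak = {m, l}) (hlm : l ≠ m)
    {k : M.Params} (hk : M.Separated k k) {U : Set M.Params} (hU : U ∈ 𝓝 k) :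
    ¬ U.InjOn M.coeffMap := by
  intro hinj
  set a := M.edgeRate k with ha
  set d := M.outRate k with hd
  set T := (Finset.univ.erase m).erase l with hT
  set K := ∏ v ∈ Finset.univ.erase m, a v with hK
  set A : (Fin n → ℝ) × ℝ → Fin n → ℝ := fun q v =>
    if v = m then (∏ v, a v + q.2) / K else if v = l then K / ∏ w ∈ T, q.1 w else q.1 v with hA
  set Φ : (Fin n → ℝ) × ℝ → M.Params := fun q => M.ofRates (A q) q.1 with hΦ
  have hlmem : l ∈ Finset.univ.erase m := Finset.mem_erase.2 ⟨hlm, Finset.mem_univ _⟩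
  have hTne : ∀ v ∈ T, v ≠ m ∧ v ≠ l := fun v hv =>
    ⟨Finset.ne_of_mem_erase (Finset.mem_of_mem_erase hv), Finset.ne_of_mem_erase hv⟩
  have hoff : ∀ v, v ≠ m → v ≠ l → d v = a v := fun v h h' =>
    outRate_eq_edgeRate k (by simp [hL, h, h'])
  have ha0 : ∀ v, a v ≠ 0 := hk.left_ne_zero
  have hK0 : K ≠ 0 := Finset.prod_ne_zero_iff.2 fun v _ => ha0 v
  have hd0 : ∀ v ∈ T, d v ≠ 0 := fun v hv => by
    rw [hoff v (hTne v hv).1 (hTne v hv).2]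
    exact ha0 v
  have hT0 : ∏ w ∈ T, d w ≠ 0 := Finset.prod_ne_zero_iff.2 hd0
  have hΦ0 : Φ (d, 0) = k := by
    have hA0 : A (d, 0) = a := by
      ext v
      simp only [hA, add_zero]
      split_ifs with h1 h2
      · rw [div_eq_iff hK0, h1, hK, Finset.mul_prod_erase _ _ (Finset.mem_univ m)]
      · rw [div_eq_iff hT0, h2, hK, ← Finset.mul_prod_erase _ _ hlmem]
        congr 1
        exact Finset.prod_congr rfl fun w hw => (hoff w (hTne w hw).1 (hTne w hw).2).symm
      · exact hoff v h1 h2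
    simp only [hΦ, hA0]
    exact ofRates_edgeRate_outRate hM k
  have hcont : ContinuousAt Φ (d, 0) := by
    refine (continuous_ofRates M).continuousAt.comp (f := fun q => (A q, q.1)) ?_
    refine ContinuousAt.prodMk (continuousAt_pi.2 fun v => ?_) continuousAt_fst
    simp only [hA]
    split_ifs
    · fun_prop
    · exact continuousAt_const.div (by fun_prop) hT0
    · fun_prop
  have hnear : ∀ᶠ q in 𝓝 d ×ˢ 𝓝 (0 : ℝ), Φ q ∈ U ∧ ∀ v ∈ T, q.1 v ≠ 0 := by
    rw [← nhds_prod_eq]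
    refine (hcont.eventually_mem (by rwa [hΦ0])).and ?_
    refine (Finset.eventually_all T).2 fun v hv => ?_
    have hc : Continuous fun q : (Fin n → ℝ) × ℝ => q.1 v := by fun_prop
    exact hc.continuousAt.eventually_ne (hd0 v hv)
  obtain ⟨pW, hW, pV, hV, hWV⟩ := Filter.eventually_prod_iff.1 hnear
  have hinjd : Function.Injective d := fun v w hvw => by
    by_contra hne
    exact hk.outRate_ne v w hne hvw
  have hev : ∀ᶠ h in 𝓝[≠] (0 : ℝ), pV h ∧ h ≠ 0 ∧ ∃ d' ∈ {d' | pW d'},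
      ∏ i, (Polynomial.X + Polynomial.C (d' i)) =
        ∏ i, (Polynomial.X + Polynomial.C (d i)) + Polynomial.C h :=
    (hV.filter_mono nhdsWithin_le_nhds).and (Filter.Eventually.and self_mem_nhdsWithin
      ((eventually_exists_prod_X_add_C_eq hinjd hW).filter_mono nhdsWithin_le_nhds))
  obtain ⟨h, hVh, hh0, d', hd'W, hroots⟩ := hev.exists
  obtain ⟨hΦU, hd'0⟩ := hWV hd'W hVh
  have hΦa : M.edgeRate (Φ (d', h)) = A (d', h) := edgeRate_ofRates hM _ _
  have hΦd : M.outRate (Φ (d', h)) = d' := outRate_ofRates hM fun v hv => by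
    simp only [hL, Finset.mem_insert, Finset.mem_singleton, not_or] at hv
    simp [hA, hv.1, hv.2]
  have hprodK : ∏ v ∈ Finset.univ.erase m, A (d', h) v = K := by
    have hAT : ∏ v ∈ T, A (d', h) v = ∏ v ∈ T, d' v :=
      Finset.prod_congr rfl fun v hv => by simp [hA, (hTne v hv).1, (hTne v hv).2]
    rw [← Finset.mul_prod_erase _ _ hlmem, ← hT, hAT]
    simp only [hA, if_neg hlm, if_true]
    exact div_mul_cancel₀ _ (Finset.prod_ne_zero_iff.2 hd'0)
  have hprod : ∏ v, A (d', h) v = ∏ v, a v + h := by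
    rw [← Finset.mul_prod_erase _ _ (Finset.mem_univ m), hprodK]
    simp only [hA, if_true]
    exact div_mul_cancel₀ _ hK0
  have hcoeff : M.coeffMap (Φ (d', h)) = M.coeffMap k := by
    refine (coeffMap_eq_iff hM).2 ⟨?_, fun i hi j hj => ?_⟩
    · rw [outputPoly_eq_prod hM, outputPoly_eq_prod hM, hΦa, hΦd, hroots, hprod,
        Polynomial.C_add]
      ring
    · rw [hOut, Finset.mem_singleton] at hi
      rw [hIn, Finset.mem_singleton] at hj
      rw [inputPoly_eq_prod hM, inputPoly_eq_prod hM, hi, hj, passed_of_add_one_eq rfl,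
        avoided_of_add_one_eq rfl, hΦa, hprodK]
      simp [hK, ha]
  have hΦk := hinj hΦU (mem_of_mem_nhds hU) hcoeff
  rw [hΦk] at hΦa
  rw [← hΦa] at hprod
  exact hh0 (by simpa [← ha] using hprod)

theorem GenericallyLocallyIdentifiable.isLeakInterlacing (hM : M.IsDirectedCycle)
    (h : M.GenericallyLocallyIdentifiable) : M.IsLeakInterlacing := by
  obtain ⟨k, ⟨U, hU, hinj⟩, hk⟩ := (h.and (ae_separated hM)).exists
  refine ⟨?_, or_iff_not_imp_left.2 fun hcard => ⟨by omega, fun α => ?_⟩⟩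
  · rintro ⟨j, hIn, hOut, hcard, hmem⟩
    obtain ⟨m, rfl⟩ : ∃ m : Fin n, j = m + 1 := ⟨j - 1, by simp⟩
    rw [add_sub_cancel_right] at hOut hmem
    obtain ⟨l, hl⟩ := Finset.card_eq_one.1
      (show (M.Leak.erase m).card = 1 by rw [Finset.card_erase_of_mem hmem, hcard])
    have hlm : l ≠ m := Finset.ne_of_mem_erase (hl ▸ Finset.mem_singleton_self l)
    exact not_injOn_of_isExceptional hM hIn hOut
      (by rw [← hl, Finset.insert_erase hmem]) hlm hk hU hinj
  · by_contra hempty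
    have hS : ∀ s ∈ M.In ∪ M.Out,
        s ∉ stretch (M.leakAt α) (M.leakAt (finRotate M.Leak.card α)) :=
      fun s hs hs' => hempty ⟨s, Finset.mem_inter.2 ⟨hs', hs⟩⟩
    have hmem : ∀ β, M.leakAt β ∈ M.Leak := fun β => Finset.orderEmbOfFin_mem _ _ β
    have hne : M.leakAt α ≠ M.leakAt (finRotate M.Leak.card α) := by
      have := α.neZero
      rw [finRotate_apply]
      exact M.leakAt.injective.ne (add_one_ne_self (by omega) α).symm
    refine not_injOn_of_mem_passed_iff hM (hmem α) (hmem _) hne (fun i hi j hj => ?_)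
      (hk.left_ne_zero _) hU hinj
    exact mem_passed_iff_of_disjoint_stretch hne (hS i (Finset.mem_union_right _ hi))
      (hS j (Finset.mem_union_left _ hj))

end NotIdentifiable

end LinearCompartmentalModel

theorem mainTheorem1 {n : ℕ} [NeZero n] (M : LinearCompartmentalModel (Fin n))
    (hM : M.IsDirectedCycle) :
    M.GenericallyLocallyIdentifiable ↔ M.IsLeakInterlacing :=
  ⟨fun h => h.isLeakInterlacing hM, fun h => h.genericallyLocallyIdentifiable hM⟩
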